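/- Let $\mathcal M$ be a finite set, $N=|\mathcal M|\ge 3$, and let $\mathcal H$ be a two-dimensional (complex or real) Hilbert space. An ensemble is a map $M$ from $\mathcal M$ to the positive semidefinite operators on $\mathcal H$ with $\sum_{m}\operatorname{Tr} M(m)=1$. An ordering is a bijection $n:\{1,\dots,N\}\to\mathcal M$. A measurement is a family $(\Pi(n))_n$ of positive semidefinite operators indexed by the orderings, with $\sum_n \Pi(n)=\mathbb 1$. The guesswork of $M$ and $\Pi$ is $\sum_{t=1}^{N} t\sum_n \operatorname{Tr}[M(n(t))\Pi(n)]$, and $G_{\min}(M)$ is its minimum over all measurements $\Pi$. Put $$E_M(n)=\sum_{t=1}^{N}(2t-N-1)\,M(n(t)),$$ and call an ordering $n^*$ optimal if $|E_M(n^*)|\ge E_M(n)$ for every ordering $n$, where $|A|=\sqrt{A^\dagger A}$ and $A\ge B$ means that $A-B$ is positive semidefinite. Let $\|A\|_1=\operatorname{Tr}|A|$. Suppose that the range of $M$ is proportional to a regular $N$-gon inscribed in a Bloch circle. That is, for some orthonormal basis $b_0,b_1$ of $\mathcal H$, some $\theta\in\mathbb R$ and some real $c$, the set $M(\mathcal M)$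 equals $\{c\,|\psi\rangle\langle\psi| : \psi=\cos(\varphi/2)\,b_0+\sin(\varphi/2)\,b_1,\ \varphi=\theta+2\pi k/N,\ 0\le k<N\}$. Then the following hold. 1. There are an orthonormal basis $b_0,b_1$ of $\mathcal H$ and an enumeration $\mathcal M=\{m_1,\dots,m_N\}$ such that $M(m_k)=N^{-1}|\psi_k\rangle\langle\psi_k|$ with $\psi_k=\cos(\pi k/N)\,b_0+\sin(\pi k/N)\,b_1$ for $k=1,\dots,N$. 2. An ordering $n^*$ is optimal if and only if, for some basis and enumeration as in 1, $$(n^*)^{-1}(m_k)=\begin{cases}2k,&k<\frac N2+\frac14,\\ 2N+1-2k,&\text{otherwise.}\end{cases}$$ In particular optimal orderings exist. 3. For every optimal ordering $n^*$, $$\|E_M(n^*)\|_1=\frac{2}{N\sin^{2}(\pi/N)}\sqrt{3\cos^2(\pi/N)+1}\quad\text{if }N\text{ is even,}\qquad \|E_M(n^*)\|_1=\frac{\cos(\pi/(2N))}{N\sin^{2}(\pi/(2N))}\quad\text{if }N\text{ is odd.}$$ 4. The minimum $G_{\min}(M)$ is attained, and $G_{\min}(M)=\frac{N+1}{2}-\frac12\|E_M(n^*)\|_1$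 for every optimal ordering $n^*$. -/

import Mathlib

open Module

noncomputable section

namespace Guesswork

variable {𝕜 H ι : Type*} [RCLike 𝕜] [NormedAddCommGroup H] [InnerProductSpace 𝕜 H]

/-! ### Ensembles, measurements and the minimum guesswork -/

/-- An ensemble on the finite set `ι` of messages: positive semidefinite operators whose traces
sum to one. -/
structure Ensemble (ι 𝕜 H : Type*) [Fintype ι] [RCLike 𝕜] [NormedAddCommGroup H]
    [InnerProductSpace 𝕜 H] where
  op : ι → H →ₗ[𝕜] H
  isPositive : ∀ m, (op m).IsPositive
  sum_trace : ∑ m, LinearMap.trace 𝕜 H (op m) = 1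

/-- A measurement with outcomes in the finite set `α`: positive semidefinite operators summing to
the identity. -/
structure Measurement (α 𝕜 H : Type*) [Fintype α] [RCLike 𝕜] [NormedAddCommGroup H]
    [InnerProductSpace 𝕜 H] where
  op : α → H →ₗ[𝕜] H
  isPositive : ∀ a, (op a).IsPositive
  sum_eq_id : ∑ a, op a = LinearMap.id

/-- Orderings of the messages. The time `t ∈ {1, …, |ι|}` is represented by the element
`t - 1` of `Fin |ι|`. -/
abbrev MsgOrder (ι : Type*) [Fintype ι] : Type _ := Fin (Fintype.card ι) ≃ ι

section

variable [Fintype ι]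

/-- The probability that the outcome of the measurement is the ordering `n` and that the guess at
time `t` is the correct one. -/
def jointProb [DecidableEq ι] (M : Ensemble ι 𝕜 H) (N : Measurement (MsgOrder ι) 𝕜 H)
    (n : MsgOrder ι) (t : Fin (Fintype.card ι)) : ℝ :=
  RCLike.re (LinearMap.trace 𝕜 H (M.op (n t) ∘ₗ N.op n))

/-- The probability that the guess at time `t` is the correct one. -/
def marginalProb [DecidableEq ι] (M : Ensemble ι 𝕜 H) (N : Measurement (MsgOrder ι) 𝕜 H)
    (t : Fin (Fintype.card ι)) : ℝ :=
  ∑ n : MsgOrder ι, jointProb M N n t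

/-- The guesswork: the expected number of guesses. -/
def guesswork [DecidableEq ι] (M : Ensemble ι 𝕜 H) (N : Measurement (MsgOrder ι) 𝕜 H) : ℝ :=
  ∑ t : Fin (Fintype.card ι), marginalProb M N t * ((t : ℝ) + 1)

/-- The minimum guesswork of an ensemble over all measurements. -/
def minGuesswork [DecidableEq ι] (M : Ensemble ι 𝕜 H) : ℝ :=
  sInf (Set.range fun N : Measurement (MsgOrder ι) 𝕜 H => guesswork M N)

/-- `E_M(n) = ∑ₜ (2 t - |ι| - 1) M(n(t))`, with `t` running from `1` to `|ι|`. -/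
def orderOp (M : Ensemble ι 𝕜 H) (n : MsgOrder ι) : H →ₗ[𝕜] H :=
  ∑ t : Fin (Fintype.card ι),
    (2 * ((t : 𝕜) + 1) - (Fintype.card ι : 𝕜) - 1) • M.op (n t)

end

/-! ### Absolute value and trace norm -/

/-- The operator `|x⟩⟨x|`. -/
def ketBra (x : H) : H →ₗ[𝕜] H := (InnerProductSpace.rankOne 𝕜 x x).toLinearMap

/-- The absolute value `|A| = √(A† A)`: it is diagonal in an orthonormal eigenbasis of `A† A`, with
the square roots of the eigenvalues of `A† A` (the singular values of `A`) on the diagonal. -/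
def absOp [FiniteDimensional 𝕜 H] (A : H →ₗ[𝕜] H) : H →ₗ[𝕜] H :=
  ∑ i : Fin (finrank 𝕜 H), (A.singularValues i : 𝕜) •
    ketBra (A.isSymmetric_adjoint_comp_self.eigenvectorBasis rfl i)

/-- The trace norm `‖A‖₁ = Tr |A|`. -/
def traceNorm [FiniteDimensional 𝕜 H] (A : H →ₗ[𝕜] H) : ℝ :=
  RCLike.re (LinearMap.trace 𝕜 H (absOp A))

/-- The ordering `n` satisfies `|E_M(n)| ≥ E_M(n')` in the Loewner order, for all orderings `n'`. -/
def IsOptimal [Fintype ι] [FiniteDimensional 𝕜 H] (M : Ensemble ι 𝕜 H) (n : MsgOrder ι) : Prop :=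
  ∀ n' : MsgOrder ι, orderOp M n' ≤ absOp (orderOp M n)

/-! ### Regular polygons in the Bloch circle -/

/-- The point of angle `φ` of the Bloch circle of the orthonormal basis `b`: the pure state
`|ψ⟩⟨ψ|` with `ψ = cos (φ / 2) b₀ + sin (φ / 2) b₁`, that is, the state with Bloch vector
`(cos φ, sin φ)` relative to the Pauli matrices `Z` and `X` in the basis `b`. -/
def blochState (b : OrthonormalBasis (Fin 2) 𝕜 H) (φ : ℝ) : H →ₗ[𝕜] H :=
  ketBra ((Real.cos (φ / 2) : 𝕜) • b 0 + (Real.sin (φ / 2) : 𝕜) • b 1)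

/-- The vertices of the regular `N`-gon inscribed in the Bloch circle of `b` and having a vertex at
angle `θ`. -/
def polygonVertices (b : OrthonormalBasis (Fin 2) 𝕜 H) (θ : ℝ) (N : ℕ) : Set (H →ₗ[𝕜] H) :=
  Set.range fun k : Fin N => blochState b (θ + 2 * Real.pi * (k : ℝ) / N)

/-- The range of the ensemble is proportional to a regular `|ι|`-gon in a Bloch circle. -/
def IsRegularPolygonal [Fintype ι] (M : Ensemble ι 𝕜 H) : Prop :=
  3 ≤ Fintype.card ι ∧
    ∃ (b : OrthonormalBasis (Fin 2) 𝕜 H) (θ c : ℝ),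
      Set.range M.op = (fun ρ => (c : 𝕜) • ρ) '' polygonVertices b θ (Fintype.card ι)

/-- A labelling of the messages by `1, …, |ι|` (the label `k` being represented by the element
`k - 1` of `Fin |ι|`) such that the message with label `k` is encoded in `|ι|⁻¹ |ψₖ⟩⟨ψₖ|`, where
`ψₖ = cos (π k / |ι|) b₀ + sin (π k / |ι|) b₁`. -/
def IsCyclicLabelling [Fintype ι] (M : Ensemble ι 𝕜 H) (b : OrthonormalBasis (Fin 2) 𝕜 H)
    (l : ι ≃ Fin (Fintype.card ι)) : Prop :=
  ∀ m, M.op m = ((Fintype.card ι : 𝕜)⁻¹) •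
    blochState b (2 * Real.pi * ((l m : ℝ) + 1) / Fintype.card ι)

/-! ### The explicit ordering -/

/-- The time, in `{1, …, N}`, at which the vertex with label `k ∈ {1, …, N}` is guessed:
`2 k` if `k < N / 2 + 1 / 4`, and `2 N + 1 - 2 k` otherwise. -/
def guessTime (N k : ℕ) : ℕ :=
  if 4 * k < 2 * N + 1 then 2 * k else 2 * N + 1 - 2 * k

lemma guessTime_mem {N k : ℕ} (h1 : 1 ≤ k) (h2 : k ≤ N) :
    1 ≤ guessTime N k ∧ guessTime N k ≤ N := by
  unfold guessTime
  split_ifs <;> omega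

lemma guessTime_inj {N j k : ℕ} (hj : j ≤ N) (hk : k ≤ N) (h : guessTime N j = guessTime N k) :
    j = k := by
  unfold guessTime at h
  split_ifs at h <;> omega

/-- `guessTime` as a permutation of `{1, …, N}`, represented by `Fin N`. -/
def guessTimeEquiv (N : ℕ) : Fin N ≃ Fin N :=
  Equiv.ofBijective
    (fun k => ⟨guessTime N (k + 1) - 1, by
      have h := guessTime_mem (N := N) (k := k + 1) (by omega) (by omega)
      omega⟩)
    (Finite.injective_iff_bijective.mp (by
      intro j k h
      have hj := guessTime_mem (N := N) (k := j + 1) (by omega) (by omega)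
      have hk := guessTime_mem (N := N) (k := k + 1) (by omega) (by omega)
      have h' : guessTime N (j + 1) - 1 = guessTime N (k + 1) - 1 := congrArg Fin.val h
      have := guessTime_inj (N := N) (j := j + 1) (k := k + 1) (by omega) (by omega) (by omega)
      exact Fin.ext (by omega)))

/-- The ordering that guesses the message with label `k` at time `guessTime |ι| k`. -/
def explicitOrder [Fintype ι] (l : ι ≃ Fin (Fintype.card ι)) : MsgOrder ι :=
  (l.trans (guessTimeEquiv (Fintype.card ι))).symm

end Guesswork

end

open Guesswork

noncomputable section

namespace Guesswork

variable {𝕜 H ι : Type*} [RCLike 𝕜] [NormedAddCommGroup H] [InnerProductSpace 𝕜 H]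

/-! Each message operator is `(2N)⁻¹(1 + blochOp b u)` with `u` a vertex of the polygon in the unit
circle of `ℂ`. The weights `2t - N - 1` sum to zero, so the identity parts cancel and `orderOp M n`
is `(2N)⁻¹` times the Bloch operator of the planar vector `blochSum φ n`. A Bloch operator squares
to `‖z‖²` times the identity, so its absolute value is scalar, and the Loewner condition for
optimality says that `n` maximizes `‖blochSum φ n‖` (`isOptimal_iff_norm_blochSum_le`). A maximizer
exists because there are finitely many orderings.

Let `v` be the sum at a maximizer. No transposition of two guesses lengthens it, which forces the
vertices to be guessed in strictly increasing order of their component along `v`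
(`inner_lt_inner_of_norm_sum_swap_le`). In particular there are no ties, so `v` lies on no symmetry
axis of the polygon, and the sorted order is the zigzag `guessTime` up to a rotation and a
reflection (`exists_sign_of_strictMono_cos`); both are absorbed into the basis
(`exists_basis_blochState`). Hence every optimal ordering is explicit. All explicit orderings give
the same norm `‖explicitSum N‖`, so all of them are optimal, and an arithmetic-geometric sum
evaluates the norm.

The guesswork is `(N + 1) / 2` plus half of `∑ n, Tr (E(n) Π(n))`. Reversing an ordering negates
`E`, so the optimal absolute value bounds every `E(n)` from below as well; measuring in the
eigenbasis of an optimal `E(n)`, with outcomes `n` and its reversal, attains the bound. -/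

/-- The traceless operator `x Z + y X` with Bloch vector `z = x + i y`, where `Z` and `X` are the
Pauli matrices in the basis `b`. -/
def blochOp (b : OrthonormalBasis (Fin 2) 𝕜 H) (z : ℂ) : H →ₗ[𝕜] H :=
  (z.re : 𝕜) • (ketBra (b 0) - ketBra (b 1)) +
    (z.im : 𝕜) • ((InnerProductSpace.rankOne 𝕜 (b 0) (b 1)).toLinearMap +
      (InnerProductSpace.rankOne 𝕜 (b 1) (b 0)).toLinearMap)

lemma ketBra_apply (x y : H) : ketBra (𝕜 := 𝕜) x y = inner 𝕜 x y • x := rfl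

lemma isPositive_ketBra (x : H) : (ketBra (𝕜 := 𝕜) x).IsPositive :=
  (InnerProductSpace.isPositive_rankOne_self x).toLinearMap

/-- Writing `B` as a sum of operators `|u⟩⟨u|` turns the trace into a sum of terms `⟨u, A u⟩`. -/
lemma re_trace_comp_nonneg [FiniteDimensional 𝕜 H] {A B : H →ₗ[𝕜] H} (hA : A.IsPositive)
    (hB : B.IsPositive) : 0 ≤ RCLike.re (LinearMap.trace 𝕜 H (A ∘ₗ B)) := by
  obtain ⟨m, u, hu⟩ := ContinuousLinearMap.isPositive_iff_eq_sum_rankOne.mp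
    ((LinearMap.isPositive_toContinuousLinearMap_iff B).mpr hB)
  have hB' : A ∘ₗ B = ∑ i, (InnerProductSpace.rankOne 𝕜 (A (u i)) (u i)).toLinearMap := by
    ext x
    have := congrArg (fun T : H →L[𝕜] H => T x) hu
    simp only [LinearMap.coe_toContinuousLinearMap', _root_.sum_apply] at this
    simp [this]
  rw [hB', map_sum, map_sum]
  refine Finset.sum_nonneg fun i _ => ?_
  rw [InnerProductSpace.trace_rankOne]
  exact hA.re_inner_nonneg_right (u i)

/-! ### Calculus of Bloch vectors -/

section basis

variable (b : OrthonormalBasis (Fin 2) 𝕜 H)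

lemma inner_zero_zero : inner 𝕜 (b 0) (b 0) = 1 := by simp
lemma inner_zero_one : inner 𝕜 (b 0) (b 1) = 0 := by simp [b.inner_eq_ite]
lemma inner_one_zero : inner 𝕜 (b 1) (b 0) = 0 := by simp [b.inner_eq_ite]

lemma blochOp_apply_zero (z : ℂ) : blochOp b z (b 0) = (z.re : 𝕜) • b 0 + (z.im : 𝕜) • b 1 := by
  simp [blochOp, ketBra_apply]

lemma blochOp_apply_one (z : ℂ) : blochOp b z (b 1) = (z.im : 𝕜) • b 0 - (z.re : 𝕜) • b 1 := by
  simp [blochOp, ketBra_apply]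
  abel

variable {b} in
lemma linearMap_ext {A B : H →ₗ[𝕜] H} (h0 : A (b 0) = B (b 0)) (h1 : A (b 1) = B (b 1)) :
    A = B := by
  refine b.toBasis.ext fun i => ?_
  fin_cases i <;> simpa

lemma blochOp_add (z w : ℂ) : blochOp b (z + w) = blochOp b z + blochOp b w := by
  simp only [blochOp, Complex.add_re, Complex.add_im, RCLike.ofReal_add]
  module

lemma blochOp_real_mul (r : ℝ) (z : ℂ) : blochOp b (r * z) = (r : 𝕜) • blochOp b z := by
  simp only [blochOp, Complex.re_ofReal_mul, Complex.im_ofReal_mul, RCLike.ofReal_mul]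
  module

lemma blochOp_zero : blochOp b 0 = 0 := by simp [blochOp]

lemma blochOp_sum {α : Type*} (s : Finset α) (f : α → ℂ) :
    blochOp b (∑ i ∈ s, f i) = ∑ i ∈ s, blochOp b (f i) := by
  classical
  induction s using Finset.induction_on with
  | empty => simp [blochOp_zero]
  | insert a s ha ih => simp [Finset.sum_insert ha, blochOp_add, ih]

lemma isSymmetric_blochOp (z : ℂ) : (blochOp b z).IsSymmetric := by
  intro x y
  simp only [blochOp, ketBra, LinearMap.add_apply, LinearMap.smul_apply, LinearMap.sub_apply,
    ContinuousLinearMap.coe_coe, InnerProductSpace.rankOne_apply, inner_add_left, inner_sub_left,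
    inner_smul_left, inner_add_right, inner_sub_right, inner_smul_right, RCLike.conj_ofReal,
    inner_conj_symm]
  ring

lemma blochOp_comp_self (z : ℂ) :
    blochOp b z ∘ₗ blochOp b z = ((‖z‖ ^ 2 : ℝ) : 𝕜) • LinearMap.id := by
  rw [← Complex.normSq_eq_norm_sq, Complex.normSq_apply]
  apply linearMap_ext (b := b) <;>
  · simp only [LinearMap.comp_apply, blochOp_apply_zero, blochOp_apply_one, map_add, map_sub,
      map_smul, LinearMap.smul_apply, LinearMap.id_apply, RCLike.ofReal_mul]
    module

lemma trace_blochOp (z : ℂ) : LinearMap.trace 𝕜 H (blochOp b z) = 0 := by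
  rw [LinearMap.trace_eq_sum_inner _ b, Fin.sum_univ_two, blochOp_apply_zero, blochOp_apply_one]
  simp [inner_add_right, inner_sub_right, inner_smul_right]

lemma blochState_eq (φ : ℝ) :
    blochState b φ = (2⁻¹ : 𝕜) • (LinearMap.id + blochOp b (Complex.exp (φ * Complex.I))) := by
  have hre : (Complex.exp (φ * Complex.I)).re = 2 * Real.cos (φ / 2) ^ 2 - 1 := by
    rw [Complex.exp_ofReal_mul_I_re, ← Real.cos_two_mul]; ring_nf
  have him : (Complex.exp (φ * Complex.I)).im = 2 * Real.sin (φ / 2) * Real.cos (φ / 2) := by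
    rw [Complex.exp_ofReal_mul_I_im, ← Real.sin_two_mul]; ring_nf
  have hs : (Real.sin (φ / 2) : 𝕜) ^ 2 = 1 - (Real.cos (φ / 2) : 𝕜) ^ 2 := by
    rw [← RCLike.ofReal_pow, Real.sin_sq]; push_cast; rfl
  have h2 : (2 : 𝕜)⁻¹ * 2 = 1 := by norm_num
  apply linearMap_ext (b := b)
  · simp only [blochState, ketBra_apply, inner_add_left, inner_smul_left, inner_zero_zero,
      inner_one_zero, RCLike.conj_ofReal, LinearMap.smul_apply, LinearMap.add_apply,
      LinearMap.id_apply, blochOp_apply_zero, hre, him]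
    push_cast
    match_scalars <;> grind
  · simp only [blochState, ketBra_apply, inner_add_left, inner_smul_left, inner_zero_one,
      b.inner_eq_one, RCLike.conj_ofReal, LinearMap.smul_apply, LinearMap.add_apply,
      LinearMap.id_apply, blochOp_apply_one, hre, him]
    push_cast
    match_scalars <;> grind

lemma isPositive_blochState (φ : ℝ) : (blochState b φ).IsPositive := isPositive_ketBra _

lemma trace_id_eq_two (b : OrthonormalBasis (Fin 2) 𝕜 H) : LinearMap.trace 𝕜 H LinearMap.id = 2 := by
  rw [LinearMap.trace_eq_sum_inner _ b, Fin.sum_univ_two]; simp; norm_num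

lemma trace_blochState (φ : ℝ) : LinearMap.trace 𝕜 H (blochState b φ) = 1 := by
  rw [blochState_eq, map_smul, map_add, trace_blochOp, trace_id_eq_two b]; simp

lemma blochState_injective_exp {φ ψ : ℝ} (h : blochState b φ = blochState b ψ) :
    Complex.exp (φ * Complex.I) = Complex.exp (ψ * Complex.I) := by
  rw [blochState_eq, blochState_eq] at h
  have h' := congrArg (fun A : H →ₗ[𝕜] H => A (b 0)) (smul_right_injective _ (by simp) h)
  simp only [LinearMap.add_apply, LinearMap.id_apply, blochOp_apply_zero, add_right_inj] at h'
  apply Complex.ext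
  · simpa [inner_add_right, inner_smul_right, inner_zero_one] using congrArg (inner 𝕜 (b 0)) h'
  · simpa [inner_add_right, inner_smul_right, inner_one_zero] using congrArg (inner 𝕜 (b 1)) h'

/-- The state of angle `φ` is the eigenprojection of the Bloch operator in direction `φ`. This
provides the test state in `le_of_blochOp_le_smul_id` and the optimal measurement. -/
lemma blochOp_mul_exp_comp_blochState (r φ : ℝ) :
    blochOp b (r * Complex.exp (φ * Complex.I)) ∘ₗ blochState b φ =
      (r : 𝕜) • blochState b φ := by
  have h := blochOp_comp_self b (Complex.exp (φ * Complex.I))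
  rw [Complex.norm_exp_ofReal_mul_I] at h
  rw [blochState_eq, blochOp_real_mul, LinearMap.smul_comp, LinearMap.comp_smul,
    LinearMap.comp_add, h]
  simp [add_comm]

lemma norm_blochOp_apply (z : ℂ) (x : H) : ‖blochOp b z x‖ = ‖z‖ * ‖x‖ := by
  have h : inner 𝕜 (blochOp b z x) (blochOp b z x) = ((‖z‖ ^ 2 : ℝ) : 𝕜) * inner 𝕜 x x := by
    rw [isSymmetric_blochOp b z, ← LinearMap.comp_apply, blochOp_comp_self]
    simp [inner_smul_right]
  rw [inner_self_eq_norm_sq_to_K, inner_self_eq_norm_sq_to_K] at h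
  have h' : ‖blochOp b z x‖ ^ 2 = (‖z‖ * ‖x‖) ^ 2 := by
    rw [mul_pow]; exact_mod_cast h
  exact (sq_eq_sq₀ (norm_nonneg _) (by positivity)).mp h'

lemma blochOp_le_smul_id {z : ℂ} {r : ℝ} (h : ‖z‖ ≤ r) :
    blochOp b z ≤ (r : 𝕜) • LinearMap.id := by
  rw [LinearMap.le_def]
  refine ⟨?_, fun x => ?_⟩
  · intro x y
    simp [inner_sub_left, inner_sub_right, inner_smul_left, inner_smul_right,
      isSymmetric_blochOp b z x y]
  · have h1 := (RCLike.re_le_norm (inner 𝕜 (blochOp b z x) x)).trans (norm_inner_le_norm _ _)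
    rw [norm_blochOp_apply] at h1
    simp only [LinearMap.sub_apply, LinearMap.smul_apply, LinearMap.id_apply, inner_sub_left,
      inner_smul_left, RCLike.conj_ofReal, map_sub, RCLike.re_ofReal_mul, inner_self_eq_norm_sq]
    nlinarith [sq_nonneg ‖x‖, mul_le_mul_of_nonneg_right h (sq_nonneg ‖x‖)]

lemma le_of_blochOp_le_smul_id {z : ℂ} {r : ℝ} [FiniteDimensional 𝕜 H]
    (h : blochOp b z ≤ (r : 𝕜) • LinearMap.id) : ‖z‖ ≤ r := by
  -- The pure state in the direction of `z` detects the largest eigenvalue `‖z‖`.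
  have h1 := re_trace_comp_nonneg ((LinearMap.le_def _ _).mp h) (isPositive_blochState b z.arg)
  rw [LinearMap.sub_comp] at h1
  nth_rw 2 [← Complex.norm_mul_exp_arg_mul_I z] at h1
  rw [blochOp_mul_exp_comp_blochState, LinearMap.smul_comp, LinearMap.id_comp, map_sub, map_smul,
    map_smul, trace_blochState] at h1
  simpa using h1

lemma blochOp_le_smul_id_iff {z : ℂ} {r : ℝ} [FiniteDimensional 𝕜 H] :
    blochOp b z ≤ (r : 𝕜) • LinearMap.id ↔ ‖z‖ ≤ r :=
  ⟨le_of_blochOp_le_smul_id b, blochOp_le_smul_id b⟩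

lemma absOp_blochOp [FiniteDimensional 𝕜 H] (z : ℂ) :
    absOp (blochOp b z) = (‖z‖ : 𝕜) • LinearMap.id := by
  have hsv : ∀ i : Fin (finrank 𝕜 H), (blochOp b z).singularValues i = ‖z‖ := by
    intro i
    have h := LinearMap.hasEigenvalue_adjoint_comp_self_sq_singularValues (blochOp b z) i.2
    rw [(isSymmetric_blochOp b z).adjoint_eq, blochOp_comp_self] at h
    obtain ⟨v, hv⟩ := h.exists_hasEigenvector
    have h1 := hv.apply_eq_smul
    simp only [LinearMap.smul_apply, LinearMap.id_apply] at h1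
    have h2 := smul_left_injective 𝕜 hv.2 h1
    have h3 : ‖z‖ ^ 2 = (blochOp b z).singularValues i ^ 2 := by exact_mod_cast h2
    exact ((sq_eq_sq₀ (norm_nonneg _) (LinearMap.singularValues_nonneg _ _)).mp h3).symm
  unfold absOp
  simp only [hsv, ← Finset.smul_sum]
  congr 1
  ext x
  simp only [LinearMap.sum_apply, ketBra_apply, LinearMap.id_apply]
  exact OrthonormalBasis.sum_repr' _ _

/-- The Bloch circle of `b`, rotated by `τ` and, if `s = -1`, reflected, is again a Bloch
circle. -/
lemma exists_basis_blochState (τ : ℝ) {s : ℝ} (hs : s = 1 ∨ s = -1) :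
    ∃ b' : OrthonormalBasis (Fin 2) 𝕜 H, ∀ φ, blochState b (τ + s * φ) = blochState b' φ := by
  have hs2 : s * s = 1 := by rcases hs with rfl | rfl <;> norm_num
  obtain ⟨C, hC⟩ : ∃ C, C = Real.cos (τ / 2) := ⟨_, rfl⟩
  obtain ⟨S, hS⟩ : ∃ S, S = Real.sin (τ / 2) := ⟨_, rfl⟩
  have hcs : (C : 𝕜) * C + S * S = 1 := by
    have := Real.cos_sq_add_sin_sq (τ / 2)
    rw [← hC, ← hS, sq, sq] at this
    exact_mod_cast this
  have hs2' : (s : 𝕜) * s = 1 := by exact_mod_cast hs2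
  -- A rotation by `τ` of the circle rotates the basis by `τ / 2`; the sign `s` on the second vector
  -- reflects the circle.
  let v : Fin 2 → H := ![(C : 𝕜) • b 0 + (S : 𝕜) • b 1,
    (s : 𝕜) • ((C : 𝕜) • b 1 - (S : 𝕜) • b 0)]
  have hv : Orthonormal 𝕜 v := by
    rw [orthonormal_iff_ite]
    intro i j
    fin_cases i <;> fin_cases j <;>
      simp [v, inner_add_left, inner_add_right, inner_sub_left, inner_sub_right, inner_smul_left,
        inner_smul_right, -inner_self_eq_norm_sq_to_K, b.inner_eq_one] <;> grind
  have hspan : ⊤ ≤ Submodule.span 𝕜 (Set.range v) := by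
    have : finrank 𝕜 H = 2 := by simpa using Module.finrank_eq_card_basis b.toBasis
    rw [hv.linearIndependent.span_eq_top_of_card_eq_finrank (by simp [this])]
  refine ⟨OrthonormalBasis.mk hv hspan, fun φ => ?_⟩
  unfold blochState
  congr 1
  have h0 : OrthonormalBasis.mk hv hspan 0 = v 0 := by simp
  have h1 : OrthonormalBasis.mk hv hspan 1 = v 1 := by simp
  have e : (τ + s * φ) / 2 = τ / 2 + s * (φ / 2) := by ring
  have ec : Real.cos (s * (φ / 2)) = Real.cos (φ / 2) := by
    rcases hs with rfl | rfl <;> simp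
  have es : Real.sin (s * (φ / 2)) = s * Real.sin (φ / 2) := by
    rcases hs with rfl | rfl <;> simp
  rw [h0, h1, e, Real.cos_add, Real.sin_add, ec, es, ← hC, ← hS]
  simp only [v, Matrix.cons_val_zero, Matrix.cons_val_one]
  push_cast
  module

end basis

/-! ### Sorting the vertices of a regular polygon by first coordinate -/

lemma exp_mul_I_eq_of_dvd {N : ℕ} (hN : N ≠ 0) (θ : ℝ) {k k' : ℤ} (h : (N : ℤ) ∣ k - k') :
    Complex.exp ((θ + 2 * Real.pi * k / N : ℝ) * Complex.I) =
      Complex.exp ((θ + 2 * Real.pi * k' / N : ℝ) * Complex.I) := by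
  obtain ⟨j, hj⟩ := h
  have hN' : (N : ℂ) ≠ 0 := by exact_mod_cast hN
  rw [Complex.exp_eq_exp_iff_exists_int]
  refine ⟨j, ?_⟩
  obtain rfl : k = k' + N * j := by omega
  push_cast
  field_simp
  ring

/-- A regular polygon whose vertices have distinct first coordinates is in general position with
respect to the first coordinate axis. -/
lemma exists_offset_of_cos_injective {N : ℕ} (hN : 3 ≤ N) (θ : ℝ)
    (h : ∀ k k' : ℤ, Real.cos (θ + 2 * Real.pi * k / N) = Real.cos (θ + 2 * Real.pi * k' / N) →
      (N : ℤ) ∣ k - k') :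
    ∃ (s j : ℤ) (β : ℝ), (s = 1 ∨ s = -1) ∧ 0 < β ∧ β < Real.pi / N ∧
      θ = s * (Real.pi - β) + 2 * Real.pi * j / N := by
  have hN' : (0 : ℝ) < N := by positivity
  have hpi := Real.pi_pos
  obtain ⟨j, hj⟩ : ∃ j, j = round ((θ - Real.pi) * N / (2 * Real.pi)) := ⟨_, rfl⟩
  -- The signed angle from `π` to the vertex `-j`, a vertex nearest to `π`.
  obtain ⟨γ, hγ⟩ : ∃ γ, γ = θ - Real.pi - 2 * Real.pi * j / N := ⟨_, rfl⟩
  have hle : |γ| ≤ Real.pi / N := by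
    have h1 := abs_sub_round ((θ - Real.pi) * N / (2 * Real.pi))
    rw [← hj] at h1
    have h2 : γ = 2 * Real.pi / N * ((θ - Real.pi) * N / (2 * Real.pi) - j) := by
      rw [hγ]; field_simp
    rw [h2, abs_mul, abs_of_pos (by positivity)]
    calc _ ≤ 2 * Real.pi / N * (1 / 2) := by gcongr
      _ = _ := by ring
  -- Under this equation the vertices `a - j` and `b - j` are mirror images in the first axis, hence
  -- have equal cosines. The values `0` and `±π / N` of `γ` would thus make `N` divide `2` or `1`.
  have tie : ∀ (a b : ℤ), 2 * γ + 2 * Real.pi * (a + b) / N = 0 → (N : ℤ) ∣ a - b := by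
    intro a b hab
    have := h (a - j) (b - j) (by
      have h1 : θ + 2 * Real.pi * ((a - j : ℤ) : ℝ) / N =
          Real.pi - (γ + 2 * Real.pi * b / N) := by
        have : 2 * Real.pi * (a + b) / N = 2 * Real.pi * a / N + 2 * Real.pi * b / N := by ring
        have : 2 * Real.pi * ((a : ℝ) - j) / N = 2 * Real.pi * a / N - 2 * Real.pi * j / N := by
          ring
        push_cast
        linarith
      have h2 : θ + 2 * Real.pi * ((b - j : ℤ) : ℝ) / N =
          (γ + 2 * Real.pi * b / N) + Real.pi := by
        rw [hγ]; push_cast; ring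
      rw [h1, h2, Real.cos_pi_sub, Real.cos_add_pi])
    simpa using this
  have h0 : γ ≠ 0 := fun h0 => by
    have := Int.le_of_dvd (by norm_num) (tie 1 (-1) (by simp [h0]))
    omega
  have h1 : γ ≠ Real.pi / N := fun h1 => by
    have := Int.le_of_dvd (by norm_num) (tie 0 (-1) (by rw [h1]; push_cast; ring))
    omega
  have h2 : γ ≠ -(Real.pi / N) := fun h1 => by
    have := Int.le_of_dvd (by norm_num) (tie 1 0 (by rw [h1]; push_cast; ring))
    omega
  rw [abs_le] at hle
  rcases lt_or_gt_of_ne h0 with hneg | hpos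
  · refine ⟨1, j, -γ, Or.inl rfl, by linarith, ?_, ?_⟩
    · have := lt_of_le_of_ne hle.1 h2.symm
      linarith
    · rw [hγ]; push_cast; ring
  -- The added `N` is a full turn, since `-(π - γ)` and `π + γ` differ by `2π`.
  · refine ⟨-1, j + N, γ, Or.inr rfl, hpos, lt_of_le_of_ne hle.2 h1, ?_⟩
    rw [hγ]; push_cast; field_simp; ring

/-- Up to sign and a multiple of `2π`, the angle `2πk/N - β` lies in the interval
`(π(t-1)/N, πt/N)` determined by the guessing time `t` of `k`. -/
lemma exists_cos_eq_of_guessTime {N k : ℕ} (h1 : 1 ≤ k) (h2 : k ≤ N) {β : ℝ} (h0 : 0 < β)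
    (hβ : β < Real.pi / N) :
    ∃ d, Real.cos (2 * Real.pi * k / N - β) = Real.cos d ∧
      Real.pi * (guessTime N k - 1) / N < d ∧ d < Real.pi * guessTime N k / N := by
  have hN : (0 : ℝ) < N := by exact_mod_cast (by omega : 0 < N)
  unfold guessTime
  split_ifs with h
  · refine ⟨_, rfl, ?_, ?_⟩
    · have : Real.pi * (((2 * k : ℕ) : ℝ) - 1) / N = 2 * Real.pi * k / N - Real.pi / N := by
        push_cast; ring
      linarith
    · have : Real.pi * ((2 * k : ℕ) : ℝ) / N = 2 * Real.pi * k / N := by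
        push_cast; ring
      linarith
  · have hc : ((2 * N + 1 - 2 * k : ℕ) : ℝ) = 2 * N + 1 - 2 * k := by
      rw [Nat.cast_sub (by omega)]; push_cast; ring
    have e : Real.pi * (2 * N + 1 - 2 * k) / N =
        2 * Real.pi - 2 * Real.pi * k / N + Real.pi / N := by
      field_simp
      ring
    have e' : Real.pi * (2 * N + 1 - 2 * k - 1) / N = 2 * Real.pi - 2 * Real.pi * k / N := by
      field_simp; ring
    refine ⟨2 * Real.pi - (2 * Real.pi * k / N - β), (Real.cos_two_pi_sub _).symm, ?_, ?_⟩
    · rw [hc, e']; linarith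
    · rw [hc, e]; linarith

lemma cos_lt_cos_of_guessTime_lt {N k k' : ℕ} (h1 : 1 ≤ k) (h2 : k ≤ N) (h1' : 1 ≤ k')
    (h2' : k' ≤ N) {β : ℝ} (h0 : 0 < β) (hβ : β < Real.pi / N)
    (h : guessTime N k < guessTime N k') :
    Real.cos (2 * Real.pi * k' / N - β) < Real.cos (2 * Real.pi * k / N - β) := by
  have hN : (0 : ℝ) < N := by exact_mod_cast (by omega : 0 < N)
  have hpi := Real.pi_pos
  obtain ⟨d, hd, hd1, hd2⟩ := exists_cos_eq_of_guessTime h1 h2 h0 hβ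
  obtain ⟨d', hd', hd1', hd2'⟩ := exists_cos_eq_of_guessTime h1' h2' h0 hβ
  rw [hd, hd']
  -- The intervals attached to distinct times are disjoint and lie in `[0, π]`, where the cosine
  -- decreases.
  have ht : (1 : ℝ) ≤ guessTime N k := by exact_mod_cast (guessTime_mem h1 h2).1
  have ht' : (guessTime N k' : ℝ) ≤ N := by exact_mod_cast (guessTime_mem h1' h2').2
  have htt : (guessTime N k : ℝ) ≤ guessTime N k' - 1 := by
    have : ((guessTime N k + 1 : ℕ) : ℝ) ≤ guessTime N k' := by exact_mod_cast h
    push_cast at this; linarith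
  apply Real.cos_lt_cos_of_nonneg_of_le_pi
  · exact le_trans (div_nonneg (mul_nonneg hpi.le (by linarith)) hN.le) hd1.le
  · refine hd2'.le.trans ?_
    rw [div_le_iff₀ hN]
    gcongr
  · refine hd2.trans (lt_of_le_of_lt ?_ hd1')
    gcongr

lemma strictMono_neg_cos_guessTimeEquiv_symm (N : ℕ) {β : ℝ} (h0 : 0 < β)
    (hβ : β < Real.pi / N) :
    StrictMono fun t : Fin N =>
      -Real.cos (2 * Real.pi * (((guessTimeEquiv N).symm t : ℕ) + 1 : ℕ) / N - β) := by
  intro t t' h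
  obtain ⟨k, rfl⟩ := (guessTimeEquiv N).surjective t
  obtain ⟨k', rfl⟩ := (guessTimeEquiv N).surjective t'
  simp only [Equiv.symm_apply_apply]
  have h' : guessTime N (k + 1) - 1 < guessTime N (k' + 1) - 1 := h
  exact neg_lt_neg (cos_lt_cos_of_guessTime_lt (by omega) (by omega) (by omega) (by omega) h0 hβ
    (by omega))

/-- If the vertices of a regular polygon are enumerated by increasing first coordinate, without
ties, then the enumeration is the explicit one up to a rotation and a reflection. -/
lemma exists_sign_of_strictMono_cos {N : ℕ} (hN : 3 ≤ N) (θ : ℝ) (p : Fin N ≃ Fin N)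
    (hp : StrictMono fun t => Real.cos (θ + 2 * Real.pi * (p t : ℕ) / N)) :
    ∃ s τ : ℝ, (s = 1 ∨ s = -1) ∧ ∀ t,
      Complex.exp ((θ + 2 * Real.pi * (p t : ℕ) / N : ℝ) * Complex.I) =
      Complex.exp ((τ + s * (2 * Real.pi * (((guessTimeEquiv N).symm t : ℕ) + 1) / N) : ℝ) *
        Complex.I) := by
  have hN0 : N ≠ 0 := by omega
  have hN' : (N : ℤ) ≠ 0 := by omega
  have hvertex : ∀ k : ℤ, ∃ t, (N : ℤ) ∣ k - (p t : ℕ) := by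
    intro k
    have hnn := Int.emod_nonneg k hN'
    have hlt := Int.emod_lt_of_pos k (by omega : (0 : ℤ) < N)
    refine ⟨p.symm ⟨(k % N).toNat, by omega⟩, ?_⟩
    rw [Equiv.apply_symm_apply, Int.toNat_of_nonneg hnn]
    exact Int.dvd_self_sub_emod
  have hcos : ∀ (θ : ℝ) {k k' : ℤ}, (N : ℤ) ∣ k - k' →
      Real.cos (θ + 2 * Real.pi * k / N) = Real.cos (θ + 2 * Real.pi * k' / N) := by
    intro θ k k' h
    have := congrArg Complex.re (exp_mul_I_eq_of_dvd hN0 θ h)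
    rwa [Complex.exp_ofReal_mul_I_re, Complex.exp_ofReal_mul_I_re] at this
  have hinj : ∀ k k' : ℤ, Real.cos (θ + 2 * Real.pi * k / N) =
      Real.cos (θ + 2 * Real.pi * k' / N) → (N : ℤ) ∣ k - k' := by
    intro k k' h
    obtain ⟨t, ht⟩ := hvertex k
    obtain ⟨t', ht'⟩ := hvertex k'
    rw [hcos θ ht, hcos θ ht'] at h
    obtain rfl : t = t' := hp.injective (by exact_mod_cast h)
    have := dvd_sub ht ht'
    rwa [sub_sub_sub_cancel_right] at this
  obtain ⟨s, j, β, hs, h0, hβ, rfl⟩ := exists_offset_of_cos_injective hN θ hinj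
  have hang : ∀ k : ℕ, s * (Real.pi - β) + s * (2 * Real.pi * (k + 1) / N) =
      s * (Real.pi - β) + 2 * Real.pi * j / N + 2 * Real.pi * ((s * (k + 1) - j : ℤ) : ℝ) / N := by
    intro k
    push_cast
    ring
  -- `q t` is the position in the enumeration `p` of the vertex that the explicit enumeration puts
  -- at `t`. Both enumerations increase the first coordinate, so `q` is a strictly monotone self-map
  -- of `Fin N`, hence the identity.
  have hq : ∀ t : Fin N, ∃ t' : Fin N,
      (N : ℤ) ∣ (s * (((guessTimeEquiv N).symm t : ℕ) + 1) - j) - (p t' : ℕ) :=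
    fun t => hvertex _
  choose q hq using hq
  have hqmono : StrictMono q := by
    intro t t' h
    rw [← hp.lt_iff_lt]
    have key : ∀ t, Real.cos (s * (Real.pi - β) + 2 * Real.pi * j / N +
        2 * Real.pi * (p (q t) : ℕ) / N) =
        -Real.cos (2 * Real.pi * (((guessTimeEquiv N).symm t : ℕ) + 1 : ℕ) / N - β) := by
      intro t
      have h1 := hcos (s * (Real.pi - β) + 2 * Real.pi * j / N) (hq t)
      rw [← hang] at h1
      rw [← Real.cos_add_pi]
      have h2 := h1.symm
      rw [Int.cast_natCast] at h2
      rw [h2]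
      rcases hs with rfl | rfl
      · congr 1; push_cast; ring
      · rw [← Real.cos_neg]; congr 1; push_cast; ring
    simp only [key]
    exact strictMono_neg_cos_guessTimeEquiv_symm N h0 hβ h
  have hqid : q = id := (hqmono.range_inj strictMono_id).mp
    (by rw [(Finite.injective_iff_surjective.mp hqmono.injective).range_eq, Set.range_id])
  refine ⟨s, s * (Real.pi - β), by rcases hs with rfl | rfl <;> simp, fun t => ?_⟩
  have h1 := exp_mul_I_eq_of_dvd hN0 (s * (Real.pi - β) + 2 * Real.pi * j / N) (hq t)
  rw [← hang, hqid, id, Int.cast_natCast] at h1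
  exact h1.symm

/-! ### Transpositions and the norm of a weighted sum -/

/-- If a transposition of two vectors does not increase the norm of a weighted sum with increasing
weights, then the two vectors are sorted along the direction of the sum. -/
lemma inner_lt_inner_of_norm_sum_swap_le {α E : Type*} [Fintype α] [LinearOrder α]
    [NormedAddCommGroup E] [InnerProductSpace ℝ E] {c : α → ℝ} (hc : StrictMono c) {u : α → E}
    (hu : Function.Injective u) {a b : α} (hab : a < b)
    (h : ‖∑ t, c t • u (Equiv.swap a b t)‖ ≤ ‖∑ t, c t • u t‖) :
    inner ℝ (∑ t, c t • u t) (u a) < inner ℝ (∑ t, c t • u t) (u b) := by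
  have hsum : ∑ t, c t • u (Equiv.swap a b t) =
      ∑ t, c t • u t + (c b - c a) • (u a - u b) := by
    rw [← sub_eq_iff_eq_add', ← Finset.sum_sub_distrib, Fintype.sum_eq_add a b hab.ne]
    · rw [Equiv.swap_apply_left, Equiv.swap_apply_right]; module
    · rintro x ⟨ha, hb⟩
      rw [Equiv.swap_apply_of_ne_of_ne ha hb, sub_self]
  have hcb : 0 < c b - c a := sub_pos.mpr (hc hab)
  have hw : 0 < ‖(c b - c a) • (u a - u b)‖ :=
    norm_pos_iff.mpr (smul_ne_zero hcb.ne' (sub_ne_zero.mpr (hu.ne hab.ne)))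
  have h2 := pow_le_pow_left₀ (norm_nonneg _) h 2
  -- With `w` the change caused by the swap, `‖v + w‖ ≤ ‖v‖` gives `2⟨v, w⟩ ≤ -‖w‖² < 0`; the
  -- strictness comes from `w ≠ 0`.
  rw [hsum, norm_add_sq_real, inner_smul_right, inner_sub_right] at h2
  nlinarith [pow_pos hw 2]

/-! ### Evaluation of the explicit sum -/

lemma sum_linear_mul_geom (x a b : ℂ) (m : ℕ) :
    (1 - x) ^ 2 * ∑ k ∈ Finset.range m, (a + b * (k + 1)) * x ^ (k + 1) =
      x * (a + b - a * x) - x ^ (m + 1) * (a + b * (m + 1) - (a + b * m) * x) := by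
  induction m with
  | zero => simp
  | succ m ih => rw [Finset.sum_range_succ, mul_add, ih]; push_cast; ring

/-- The weighted sum of the vertices of the regular `N`-gon, with the weights of the explicit
ordering. -/
def explicitSum (N : ℕ) : ℂ :=
  ∑ t : Fin N, (2 * ((t : ℝ) + 1) - N - 1) •
    Complex.exp ((2 * Real.pi * (((guessTimeEquiv N).symm t : ℕ) + 1) / N : ℝ) * Complex.I)

lemma explicitSum_eq_sum_range (N : ℕ) {x : ℂ}
    (hx : x = Complex.exp ((2 * Real.pi / N : ℝ) * Complex.I)) :
    explicitSum N = ∑ k ∈ Finset.range N, (2 * guessTime N (k + 1) - N - 1 : ℂ) * x ^ (k + 1) := by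
  unfold explicitSum
  rw [← Equiv.sum_comp (guessTimeEquiv N), ← Fin.sum_univ_eq_sum_range]
  refine Finset.sum_congr rfl fun k _ => ?_
  have h : ((guessTimeEquiv N k : ℕ) : ℝ) + 1 = guessTime N (k + 1) := by
    have : (guessTimeEquiv N k : ℕ) + 1 = guessTime N (k + 1) := by
      have := (guessTime_mem (N := N) (k := k + 1) (by omega) (by omega)).1
      change guessTime N (k + 1) - 1 + 1 = _
      omega
    exact_mod_cast this
  rw [h, Equiv.symm_apply_apply, Complex.real_smul, hx, ← Complex.exp_nat_mul]
  push_cast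
  congr 2
  ring

/-- Here `K` is half of `N = K + L`, rounded down, and exactly the labels up to `K` fall in the
first case of `guessTime`. The weights rise in steps of `4` over these labels and fall in steps of
`4` over the others, so both pieces are arithmetic-geometric sums. -/
lemma explicitSum_eq_add (K L : ℕ) (hL : K ≤ L ∧ L ≤ K + 1) {x : ℂ}
    (hx : x = Complex.exp ((2 * Real.pi / (K + L : ℕ) : ℝ) * Complex.I)) :
    explicitSum (K + L) =
      ∑ k ∈ Finset.range K, (-(K + L + 1) + 4 * (k + 1) : ℂ) * x ^ (k + 1) +
      x ^ K * ∑ k ∈ Finset.range L, ((3 * L - K + 1) + -4 * (k + 1) : ℂ) * x ^ (k + 1) := by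
  rw [explicitSum_eq_sum_range (K + L) hx, Finset.sum_range_add, Finset.mul_sum]
  congr 1
  · refine Finset.sum_congr rfl fun k hk => ?_
    rw [Finset.mem_range] at hk
    rw [guessTime, if_pos (by omega)]
    push_cast
    ring
  · refine Finset.sum_congr rfl fun k hk => ?_
    rw [Finset.mem_range] at hk
    rw [guessTime, if_neg (by omega), Nat.cast_sub (by omega)]
    push_cast
    ring

lemma norm_one_sub_exp_sq (x : ℝ) :
    ‖1 - Complex.exp ((2 * x : ℝ) * Complex.I)‖ ^ 2 = 4 * Real.sin x ^ 2 := by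
  rw [← Complex.normSq_eq_norm_sq, Complex.normSq_apply, Complex.sub_re, Complex.sub_im,
    Complex.exp_ofReal_mul_I_re, Complex.exp_ofReal_mul_I_im, Real.cos_two_mul, Real.sin_two_mul,
    Complex.one_re, Complex.one_im]
  have := Real.sin_sq_add_cos_sq x
  grind

lemma norm_explicitSum_even {N : ℕ} (hN : 3 ≤ N) (h : Even N) :
    ‖explicitSum N‖ = 2 * (Real.sin (Real.pi / N) ^ 2)⁻¹ *
      √(3 * Real.cos (Real.pi / N) ^ 2 + 1) := by
  obtain ⟨K, rfl⟩ := h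
  obtain ⟨x, hx⟩ : ∃ x, x = Complex.exp ((2 * Real.pi / (K + K : ℕ) : ℝ) * Complex.I) := ⟨_, rfl⟩
  have hK : (K : ℂ) ≠ 0 := by exact_mod_cast (by omega : K ≠ 0)
  have hxK : x ^ K = -1 := by
    rw [hx, ← Complex.exp_nat_mul, ← Complex.exp_pi_mul_I]
    congr 1
    push_cast
    field_simp
    ring
  have key : (1 - x) ^ 2 * explicitSum (K + K) = 4 * (x * (3 + x)) := by
    rw [explicitSum_eq_add K K (by omega) hx, mul_add, sum_linear_mul_geom, mul_left_comm,
      sum_linear_mul_geom, pow_succ, hxK]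
    ring
  have hnx : ‖x‖ = 1 := by rw [hx, Complex.norm_exp_ofReal_mul_I]
  obtain ⟨y, hy⟩ : ∃ y, y = Real.pi / (K + K : ℕ) := ⟨_, rfl⟩
  have hxy : x = Complex.exp ((2 * y : ℝ) * Complex.I) := by rw [hx, hy, mul_div_assoc]
  have h3 : ‖3 + x‖ = 2 * √(3 * Real.cos y ^ 2 + 1) := by
    rw [← sq_eq_sq₀ (norm_nonneg _) (by positivity), mul_pow, Real.sq_sqrt (by positivity),
      ← Complex.normSq_eq_norm_sq, Complex.normSq_apply, hxy, Complex.add_re, Complex.add_im,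
      Complex.exp_ofReal_mul_I_re, Complex.exp_ofReal_mul_I_im, Real.cos_two_mul, Real.sin_two_mul]
    have := Real.sin_sq_add_cos_sq y
    simp only [Complex.re_ofNat, Complex.im_ofNat]
    grind
  have hsin : Real.sin y ≠ 0 := by
    refine (Real.sin_pos_of_pos_of_lt_pi ?_ ?_).ne'
    · rw [hy]; positivity
    · rw [hy]; exact div_lt_self Real.pi_pos (by exact_mod_cast (by omega : 1 < K + K))
  have hn := congrArg norm key
  rw [norm_mul, norm_pow, norm_mul, norm_mul, hnx, h3, hxy, norm_one_sub_exp_sq] at hn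
  rw [← hy]
  have h4 : ‖(4 : ℂ)‖ = 4 := by simp
  rw [h4] at hn
  field_simp
  linarith

lemma norm_explicitSum_odd {N : ℕ} (hN : 3 ≤ N) (h : Odd N) :
    ‖explicitSum N‖ = Real.cos (Real.pi / (2 * N)) *
      (Real.sin (Real.pi / (2 * N)) ^ 2)⁻¹ := by
  obtain ⟨K, rfl⟩ := h
  have e : 2 * K + 1 = K + (K + 1) := by omega
  rw [e] at *
  obtain ⟨y, hy⟩ : ∃ y, y = Real.pi / (2 * (K + (K + 1) : ℕ)) := ⟨_, rfl⟩
  -- For odd `N` the square root `z = exp(iπ/N)` of the primitive root is used: `z ^ N = -1` gives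
  -- `(z ^ 2) ^ K = -z⁻¹`, and a factor `(1 + z) ^ 2` cancels below.
  obtain ⟨z, hz⟩ : ∃ z, z = Complex.exp ((2 * y : ℝ) * Complex.I) := ⟨_, rfl⟩
  have hNC : ((K : ℂ) + (K + 1)) ≠ 0 := by exact_mod_cast (by omega : K + (K + 1) ≠ 0)
  have hx : z ^ 2 =
      Complex.exp ((2 * Real.pi / (K + (K + 1) : ℕ) : ℝ) * Complex.I) := by
    rw [hz, ← Complex.exp_nat_mul, hy]
    congr 1
    push_cast
    field_simp
  have hz0 : z ≠ 0 := by rw [hz]; exact Complex.exp_ne_zero _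
  have hzK : (z ^ 2) ^ K = -z⁻¹ := by
    have : z ^ (K + (K + 1)) = -1 := by
      rw [hz, ← Complex.exp_nat_mul, ← Complex.exp_pi_mul_I, hy]
      congr 1
      push_cast
      field_simp
    rw [← pow_mul, eq_neg_iff_add_eq_zero, ← mul_left_inj' hz0, add_mul, inv_mul_cancel₀ hz0,
      ← pow_succ, show 2 * K + 1 = K + (K + 1) by omega, this]
    simp
  have hcos : 0 < Real.cos y := by
    apply Real.cos_pos_of_mem_Ioo
    have : y < Real.pi / 2 := by
      rw [hy]
      apply div_lt_div_of_pos_left Real.pi_pos (by norm_num)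
      exact_mod_cast (by omega : 2 < 2 * (K + (K + 1)))
    have : 0 < y := by rw [hy]; positivity
    constructor <;> linarith [Real.pi_pos]
  have hsin : Real.sin y ≠ 0 := by
    refine (Real.sin_pos_of_pos_of_lt_pi ?_ ?_).ne'
    · rw [hy]; positivity
    · rw [hy]; exact div_lt_self Real.pi_pos (by exact_mod_cast (by omega : 1 < 2 * (K + (K + 1))))
  have hnz : ‖1 + z‖ = 2 * Real.cos y := by
    rw [← sq_eq_sq₀ (norm_nonneg _) (by positivity), ← Complex.normSq_eq_norm_sq,
      Complex.normSq_apply, hz, Complex.add_re, Complex.add_im, Complex.exp_ofReal_mul_I_re,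
      Complex.exp_ofReal_mul_I_im, Real.cos_two_mul, Real.sin_two_mul]
    have := Real.sin_sq_add_cos_sq y
    simp only [Complex.one_re, Complex.one_im]
    grind
  have h1z : 1 + z ≠ 0 := by
    rw [← norm_pos_iff, hnz]; positivity
  have key : (1 - z) ^ 2 * explicitSum (K + (K + 1)) = 2 * (z * (1 + z)) := by
    have : (1 - z ^ 2) ^ 2 * explicitSum (K + (K + 1)) = 2 * z * (1 + z) ^ 3 := by
      rw [explicitSum_eq_add K (K + 1) (by omega) hx, mul_add, sum_linear_mul_geom, mul_left_comm,
        sum_linear_mul_geom, pow_succ _ (K + 1), pow_succ _ K, hzK]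
      push_cast
      field_simp
      ring
    apply mul_left_cancel₀ (pow_ne_zero 2 h1z)
    linear_combination this
  have hn := congrArg norm key
  have h1 : ‖z‖ = 1 := by rw [hz, Complex.norm_exp_ofReal_mul_I]
  have h2 : ‖(2 : ℂ)‖ = 2 := by simp
  rw [norm_mul, norm_pow, norm_mul, norm_mul, h1, hnz, h2, hz, norm_one_sub_exp_sq] at hn
  rw [← hy]
  field_simp
  linarith

/-! ### From ensembles to sums of Bloch vectors -/

lemma blochState_congr (b : OrthonormalBasis (Fin 2) 𝕜 H) {φ ψ : ℝ}
    (h : Complex.exp (φ * Complex.I) = Complex.exp (ψ * Complex.I)) :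
    blochState b φ = blochState b ψ := by
  rw [blochState_eq, blochState_eq, h]

lemma exp_vertex_injective (N : ℕ) (θ : ℝ) : Function.Injective fun k : Fin N =>
    Complex.exp ((θ + 2 * Real.pi * (k : ℝ) / N : ℝ) * Complex.I) := by
  intro k k' h
  have hN : (N : ℂ) ≠ 0 := by exact_mod_cast (by have := k.2; omega : N ≠ 0)
  obtain ⟨j, hj⟩ := Complex.exp_eq_exp_iff_exists_int.mp h
  push_cast at hj
  field_simp at hj
  have h1 : ((k : ℕ) : ℂ) = (k' : ℕ) + N * j := by
    have hpi : (2 * Real.pi : ℂ) ≠ 0 := by simp [Real.pi_ne_zero]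
    apply mul_left_cancel₀ hpi
    linear_combination hj
  have h2 : ((k : ℕ) : ℤ) = (k' : ℕ) + N * j := by exact_mod_cast h1
  have hk := k.2
  have hk' := k'.2
  have hmod : ((k : ℕ) : ℤ) % N = ((k' : ℕ) : ℤ) % N := by
    rw [h2, Int.add_mul_emod_self_left]
  rw [Int.emod_eq_of_lt (by omega) (by omega), Int.emod_eq_of_lt (by omega) (by omega)] at hmod
  exact Fin.ext (by omega)

variable [Fintype ι]

/-- The Bloch vector of `2 |ι| E_M(n)` for the ensemble of the uniformly weighted pure states of
angles `φ`. -/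
def blochSum (φ : ι → ℝ) (n : MsgOrder ι) : ℂ :=
  ∑ t : Fin (Fintype.card ι), (2 * ((t : ℝ) + 1) - (Fintype.card ι : ℝ) - 1) •
    Complex.exp (φ (n t) * Complex.I)

lemma sum_weights (N : ℕ) : ∑ t : Fin N, (2 * ((t : ℝ) + 1) - (N : ℝ) - 1) = 0 := by
  rw [Fin.sum_univ_eq_sum_range (fun t : ℕ => 2 * ((t : ℝ) + 1) - (N : ℝ) - 1) N]
  have h : ∀ m : ℕ, ∑ t ∈ Finset.range m, (2 * ((t : ℝ) + 1) - (N : ℝ) - 1) = m * (m - N) := by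
    intro m
    induction m with
    | zero => simp
    | succ m ih => rw [Finset.sum_range_succ, ih]; push_cast; ring
  rw [h, sub_self, mul_zero]

lemma strictMono_weights (N : ℕ) :
    StrictMono fun t : Fin N => 2 * ((t : ℝ) + 1) - (N : ℝ) - 1 := by
  intro s t h
  have : ((s : ℕ) : ℝ) < (t : ℕ) := by exact_mod_cast h
  change 2 * ((s : ℝ) + 1) - (N : ℝ) - 1 < 2 * ((t : ℝ) + 1) - (N : ℝ) - 1
  linarith

lemma linearMap_sum_comp {α : Type*} [Fintype α] (A : α → H →ₗ[𝕜] H) (B : H →ₗ[𝕜] H) :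
    (∑ i, A i) ∘ₗ B = ∑ i, A i ∘ₗ B :=
  Finset.sum_mul _ _ B

lemma linearMap_comp_sum {α : Type*} [Fintype α] (A : H →ₗ[𝕜] H) (B : α → H →ₗ[𝕜] H) :
    A ∘ₗ (∑ i, B i) = ∑ i, A ∘ₗ B i :=
  Finset.mul_sum _ _ A

section uniform

variable {M : Ensemble ι 𝕜 H} {b : OrthonormalBasis (Fin 2) 𝕜 H} {φ : ι → ℝ}

lemma orderOp_eq_blochOp
    (h : ∀ m, M.op m = ((Fintype.card ι : 𝕜)⁻¹) • blochState b (φ m)) (n : MsgOrder ι) :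
    orderOp M n = blochOp b ((((2 * Fintype.card ι : ℝ)⁻¹ : ℝ) : ℂ) * blochSum φ n) := by
  have hw : ∀ t : Fin (Fintype.card ι), (2 * ((t : 𝕜) + 1) - (Fintype.card ι : 𝕜) - 1) =
      ((2 * ((t : ℝ) + 1) - (Fintype.card ι : ℝ) - 1 : ℝ) : 𝕜) := by
    intro t; push_cast; rfl
  have hs : ∑ t : Fin (Fintype.card ι),
      ((2 * ((t : ℝ) + 1) - (Fintype.card ι : ℝ) - 1 : ℝ) : 𝕜) = 0 := by
    rw [← RCLike.ofReal_sum, sum_weights, RCLike.ofReal_zero]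
  unfold orderOp
  simp only [hw, h, blochState_eq, smul_add, Finset.sum_add_distrib]
  rw [← Finset.sum_smul, hs, zero_smul, zero_add, blochOp_real_mul, blochSum, blochOp_sum,
    Finset.smul_sum]
  refine Finset.sum_congr rfl fun t _ => ?_
  rw [Complex.real_smul, blochOp_real_mul]
  simp only [smul_smul]
  congr 1
  push_cast
  rw [mul_inv]
  ring

variable [FiniteDimensional 𝕜 H]

lemma norm_inv_two_card_mul (z : ℂ) :
    ‖(((2 * Fintype.card ι : ℝ)⁻¹ : ℝ) : ℂ) * z‖ = (2 * Fintype.card ι : ℝ)⁻¹ * ‖z‖ := by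
  rw [norm_mul, Complex.norm_real, Real.norm_of_nonneg (by positivity)]

lemma absOp_orderOp
    (h : ∀ m, M.op m = ((Fintype.card ι : 𝕜)⁻¹) • blochState b (φ m)) (n : MsgOrder ι) :
    absOp (orderOp M n) =
      (((2 * Fintype.card ι : ℝ)⁻¹ * ‖blochSum φ n‖ : ℝ) : 𝕜) • LinearMap.id := by
  rw [orderOp_eq_blochOp h, absOp_blochOp, norm_inv_two_card_mul]

lemma traceNorm_orderOp
    (h : ∀ m, M.op m = ((Fintype.card ι : 𝕜)⁻¹) • blochState b (φ m)) (n : MsgOrder ι) :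
    traceNorm (orderOp M n) = (Fintype.card ι : ℝ)⁻¹ * ‖blochSum φ n‖ := by
  rw [traceNorm, absOp_orderOp h, map_smul, trace_id_eq_two b, smul_eq_mul, RCLike.re_ofReal_mul,
    RCLike.ofNat_re, mul_inv]
  ring

lemma isOptimal_iff_norm_blochSum_le [Nonempty ι]
    (h : ∀ m, M.op m = ((Fintype.card ι : 𝕜)⁻¹) • blochState b (φ m)) (n : MsgOrder ι) :
    IsOptimal M n ↔ ∀ n', ‖blochSum φ n'‖ ≤ ‖blochSum φ n‖ := by
  have hc : (0 : ℝ) < (2 * Fintype.card ι : ℝ)⁻¹ := by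
    have : 0 < Fintype.card ι := Fintype.card_pos
    positivity
  refine forall_congr' fun n' => ?_
  rw [absOp_orderOp h, orderOp_eq_blochOp h, blochOp_le_smul_id_iff, norm_inv_two_card_mul,
    mul_le_mul_iff_right₀ hc]

end uniform

/-- The unit total trace forces `c = N⁻¹`. All `N` vertices are attained and are distinct, so the
`N` messages correspond to them bijectively. -/
lemma exists_uniform_labelling {M : Ensemble ι 𝕜 H} {b : OrthonormalBasis (Fin 2) 𝕜 H} {θ c : ℝ}
    (h : Set.range M.op = (fun ρ => (c : 𝕜) • ρ) '' polygonVertices b θ (Fintype.card ι)) :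
    ∃ e : ι ≃ Fin (Fintype.card ι), ∀ m, M.op m = ((Fintype.card ι : 𝕜)⁻¹) •
      blochState b (θ + 2 * Real.pi * (e m : ℝ) / Fintype.card ι) := by
  have hex : ∀ m, ∃ k : Fin (Fintype.card ι),
      M.op m = (c : 𝕜) • blochState b (θ + 2 * Real.pi * (k : ℝ) / Fintype.card ι) := by
    intro m
    have hm : M.op m ∈ Set.range M.op := ⟨m, rfl⟩
    rw [h] at hm
    obtain ⟨_, ⟨k, rfl⟩, hk⟩ := hm
    exact ⟨k, hk.symm⟩
  choose f hf using hex
  have hc : (Fintype.card ι : 𝕜) * c = 1 := by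
    have := M.sum_trace
    simpa [hf, trace_blochState] using this
  have hc' : (c : 𝕜) = (Fintype.card ι : 𝕜)⁻¹ := eq_inv_of_mul_eq_one_right hc
  have hc0 : (c : 𝕜) ≠ 0 := right_ne_zero_of_mul_eq_one hc
  have hsurj : Function.Surjective f := by
    intro k
    have hk : (c : 𝕜) • blochState b (θ + 2 * Real.pi * (k : ℝ) / Fintype.card ι) ∈
        Set.range M.op := by
      rw [h]
      exact ⟨_, ⟨k, rfl⟩, rfl⟩
    obtain ⟨m, hm⟩ := hk
    rw [hf] at hm
    exact ⟨m, exp_vertex_injective _ θ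
      (blochState_injective_exp b (smul_right_injective _ hc0 hm))⟩
  have hbij : Function.Bijective f :=
    (Fintype.bijective_iff_surjective_and_card f).mpr ⟨hsurj, by simp⟩
  exact ⟨Equiv.ofBijective f hbij, fun m => by rw [hf, hc']; rfl⟩

lemma exists_isCyclicLabelling {M : Ensemble ι 𝕜 H} (hM : IsRegularPolygonal M) :
    ∃ (b : OrthonormalBasis (Fin 2) 𝕜 H) (l : ι ≃ Fin (Fintype.card ι)),
      IsCyclicLabelling M b l := by
  obtain ⟨_, b, θ, c, h⟩ := hM
  obtain ⟨e, he⟩ := exists_uniform_labelling h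
  obtain ⟨b', hb'⟩ := exists_basis_blochState b (θ - 2 * Real.pi / Fintype.card ι)
    (s := 1) (Or.inl rfl)
  refine ⟨b', e, fun m => ?_⟩
  rw [he, ← hb']
  congr 2
  ring

lemma blochSum_explicitOrder (l : ι ≃ Fin (Fintype.card ι)) :
    blochSum (fun m => 2 * Real.pi * ((l m : ℝ) + 1) / Fintype.card ι) (explicitOrder l) =
      explicitSum (Fintype.card ι) := by
  simp [blochSum, explicitSum, explicitOrder]

lemma exists_explicitOrder_of_isOptimal [FiniteDimensional 𝕜 H] {M : Ensemble ι 𝕜 H}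
    {b : OrthonormalBasis (Fin 2) 𝕜 H} {l : ι ≃ Fin (Fintype.card ι)}
    (hN : 3 ≤ Fintype.card ι) (hl : IsCyclicLabelling M b l) {n : MsgOrder ι}
    (hn : IsOptimal M n) :
    ∃ (b' : OrthonormalBasis (Fin 2) 𝕜 H) (l' : ι ≃ Fin (Fintype.card ι)),
      IsCyclicLabelling M b' l' ∧ n = explicitOrder l' := by
  have : Nonempty ι := Fintype.card_pos_iff.mp (by omega)
  obtain ⟨φ, hφ⟩ : ∃ φ : ι → ℝ, φ = fun m => 2 * Real.pi * ((l m : ℝ) + 1) / Fintype.card ι :=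
    ⟨_, rfl⟩
  have hM : ∀ m, M.op m = ((Fintype.card ι : 𝕜)⁻¹) • blochState b (φ m) := by
    rw [hφ]; exact hl
  rw [isOptimal_iff_norm_blochSum_le hM] at hn
  obtain ⟨v, hv⟩ : ∃ v, v = blochSum φ n := ⟨_, rfl⟩
  have hφ' : ∀ m, φ m = 2 * Real.pi / Fintype.card ι +
      2 * Real.pi * (l m : ℕ) / Fintype.card ι := by
    intro m; rw [hφ]; ring
  have hinj : Function.Injective fun t => Complex.exp (φ (n t) * Complex.I) := by
    intro t t' h
    simp only [hφ'] at h
    exact n.injective (l.injective (exp_vertex_injective _ _ h))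
  have hinner : ∀ ψ : ℝ, inner ℝ v (Complex.exp (ψ * Complex.I)) =
      ‖v‖ * Real.cos (ψ - v.arg) := by
    intro ψ
    rw [Complex.inner, Complex.mul_re, Complex.conj_re, Complex.conj_im,
      Complex.exp_ofReal_mul_I_re, Complex.exp_ofReal_mul_I_im, Real.cos_sub,
      ← Complex.norm_mul_cos_arg v, ← Complex.norm_mul_sin_arg v]
    ring
  have hmono : StrictMono fun t => Real.cos ((2 * Real.pi / Fintype.card ι - v.arg) +
      2 * Real.pi * ((n.trans l) t : ℕ) / Fintype.card ι) := by
    -- Angles are measured from the direction of `v`, which makes sorting along `v` sorting by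
    -- cosine.
    intro t t' htt
    have h1 := inner_lt_inner_of_norm_sum_swap_le (strictMono_weights (Fintype.card ι)) hinj htt
      (hn ((Equiv.swap t t').trans n))
    change inner ℝ (blochSum φ n) _ < inner ℝ (blochSum φ n) _ at h1
    rw [← hv, hinner, hinner, hφ', hφ'] at h1
    have h3 := lt_of_mul_lt_mul_left h1 (norm_nonneg v)
    rw [add_sub_right_comm, add_sub_right_comm] at h3
    exact h3
  obtain ⟨s, τ, hs, hτ⟩ := exists_sign_of_strictMono_cos hN _ _ hmono
  obtain ⟨b', hb'⟩ := exists_basis_blochState b (v.arg + τ) hs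
  -- The labelling is forced by `n = explicitOrder l'`; what remains is that it is cyclic for the
  -- rotated or reflected basis.
  refine ⟨b', n.symm.trans (guessTimeEquiv _).symm, fun m => ?_, ?_⟩
  · rw [hM, ← hb']
    congr 1
    apply blochState_congr
    obtain ⟨t, rfl⟩ := n.surjective m
    have h := congrArg (fun z => Complex.exp (v.arg * Complex.I) * z) (hτ t)
    simp only [← Complex.exp_add, ← add_mul, ← Complex.ofReal_add] at h
    convert h using 4
    · rw [hφ']; simp; ring
    · simp; ring
  · ext t
    simp [explicitOrder]

lemma orderOp_revPerm_trans (M : Ensemble ι 𝕜 H) (n : MsgOrder ι) :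
    orderOp M (Fin.revPerm.trans n) = -orderOp M n := by
  unfold orderOp
  rw [← Equiv.sum_comp Fin.revPerm, ← Finset.sum_neg_distrib]
  refine Finset.sum_congr rfl fun t _ => ?_
  have ht : (((Fin.revPerm t : Fin (Fintype.card ι)) : ℕ) : 𝕜) =
      (Fintype.card ι : 𝕜) - ((t : 𝕜) + 1) := by
    rw [Fin.revPerm_apply, Fin.val_rev, Nat.cast_sub (by omega)]
    push_cast
    ring
  rw [ht, ← neg_smul, Equiv.trans_apply, Fin.revPerm_apply, Fin.revPerm_apply, Fin.rev_rev]
  congr 1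
  ring

/-! ### Bounds on the guesswork and their attainment -/

section guesswork

variable [DecidableEq ι]

/-- Each time is `t = (N + 1) / 2 + (2t - N - 1) / 2`, and the joint probabilities sum to one. -/
lemma guesswork_eq [FiniteDimensional 𝕜 H] (M : Ensemble ι 𝕜 H)
    (P : Measurement (MsgOrder ι) 𝕜 H) :
    guesswork M P = ((Fintype.card ι : ℝ) + 1) / 2 +
      1 / 2 * ∑ n, RCLike.re (LinearMap.trace 𝕜 H (orderOp M n ∘ₗ P.op n)) := by
  have h1 : ∀ n, ∑ t, jointProb M P n t =
      RCLike.re (LinearMap.trace 𝕜 H ((∑ m, M.op m) ∘ₗ P.op n)) := by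
    intro n
    simp only [jointProb]
    rw [Equiv.sum_comp n (fun m => RCLike.re (LinearMap.trace 𝕜 H (M.op m ∘ₗ P.op n))),
      linearMap_sum_comp, map_sum, map_sum]
  have h2 : ∑ n, ∑ t, jointProb M P n t = 1 := by
    simp only [h1]
    rw [← map_sum, ← map_sum, ← linearMap_comp_sum, P.sum_eq_id, LinearMap.comp_id, map_sum,
      M.sum_trace, RCLike.one_re]
  have h3 : ∀ n, RCLike.re (LinearMap.trace 𝕜 H (orderOp M n ∘ₗ P.op n)) =
      ∑ t : Fin (Fintype.card ι),
        (2 * ((t : ℝ) + 1) - (Fintype.card ι : ℝ) - 1) * jointProb M P n t := by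
    intro n
    rw [orderOp, linearMap_sum_comp, map_sum, map_sum]
    refine Finset.sum_congr rfl fun t _ => ?_
    have hw : (2 * ((t : 𝕜) + 1) - (Fintype.card ι : 𝕜) - 1) =
        ((2 * ((t : ℝ) + 1) - (Fintype.card ι : ℝ) - 1 : ℝ) : 𝕜) := by
      push_cast; rfl
    rw [hw, LinearMap.smul_comp, map_smul, smul_eq_mul, RCLike.re_ofReal_mul, jointProb]
  have h4 : guesswork M P = ∑ n, ∑ t, jointProb M P n t * ((t : ℝ) + 1) := by
    simp only [guesswork, marginalProb, Finset.sum_mul]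
    exact Finset.sum_comm
  have h5 : ((Fintype.card ι : ℝ) + 1) / 2 =
      ((Fintype.card ι : ℝ) + 1) / 2 * ∑ n, ∑ t, jointProb M P n t := by
    rw [h2, mul_one]
  rw [h4, h5]
  simp only [h3, Finset.mul_sum, ← Finset.sum_add_distrib]
  refine Finset.sum_congr rfl fun n _ => Finset.sum_congr rfl fun t _ => ?_
  ring

/-- The hypothesis at the reversed ordering reads `-E(n) ≤ r`. Pairing it with `Π(n)` and summing
uses `Tr 1 = 2`, which cancels the factor one half. -/
lemma le_guesswork [FiniteDimensional 𝕜 H] (hdim : finrank 𝕜 H = 2) {M : Ensemble ι 𝕜 H} {r : ℝ}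
    (h : ∀ n, orderOp M n ≤ (r : 𝕜) • LinearMap.id) (P : Measurement (MsgOrder ι) 𝕜 H) :
    ((Fintype.card ι : ℝ) + 1) / 2 - r ≤ guesswork M P := by
  have h1 : ∀ n, -(r * RCLike.re (LinearMap.trace 𝕜 H (P.op n))) ≤
      RCLike.re (LinearMap.trace 𝕜 H (orderOp M n ∘ₗ P.op n)) := by
    intro n
    have h2 := re_trace_comp_nonneg ((LinearMap.le_def _ _).mp (h (Fin.revPerm.trans n)))
      (P.isPositive n)
    rw [orderOp_revPerm_trans, sub_neg_eq_add, LinearMap.add_comp, LinearMap.smul_comp,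
      LinearMap.id_comp, map_add, map_smul, map_add, smul_eq_mul, RCLike.re_ofReal_mul] at h2
    linarith
  have h2 : ∑ n, RCLike.re (LinearMap.trace 𝕜 H (P.op n)) = 2 := by
    rw [← map_sum, ← map_sum, P.sum_eq_id, LinearMap.trace_id, hdim]
    simp
  have h3 := Finset.sum_le_sum fun n (_ : n ∈ Finset.univ) => h1 n
  rw [Finset.sum_neg_distrib, ← Finset.mul_sum, h2] at h3
  rw [guesswork_eq]
  linarith

lemma exists_guesswork_eq [FiniteDimensional 𝕜 H] {M : Ensemble ι 𝕜 H}
    (hN : 2 ≤ Fintype.card ι) {b : OrthonormalBasis (Fin 2) 𝕜 H} {n : MsgOrder ι} {z : ℂ}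
    (h : orderOp M n = blochOp b z) :
    ∃ P : Measurement (MsgOrder ι) 𝕜 H,
      guesswork M P = ((Fintype.card ι : ℝ) + 1) / 2 - ‖z‖ := by
  have hne : n ≠ Fin.revPerm.trans n := by
    intro h
    have h0 := DFunLike.congr_fun h ⟨0, by omega⟩
    have h1 := congrArg Fin.val (n.injective h0)
    simp [Fin.val_rev] at h1
    omega
  have hexp : Complex.exp (((z.arg + Real.pi : ℝ) : ℂ) * Complex.I) =
      -Complex.exp (z.arg * Complex.I) := by
    rw [Complex.ofReal_add, add_mul, Complex.exp_add, Complex.exp_pi_mul_I, mul_neg_one]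
  have hz : blochOp b z =
      blochOp b (((-‖z‖ : ℝ) : ℂ) * Complex.exp (((z.arg + Real.pi : ℝ) : ℂ) * Complex.I)) := by
    rw [hexp, Complex.ofReal_neg, neg_mul_neg, Complex.norm_mul_exp_arg_mul_I]
  have hz' : blochOp b z = blochOp b ((‖z‖ : ℂ) * Complex.exp (z.arg * Complex.I)) := by
    rw [Complex.norm_mul_exp_arg_mul_I]
  have hadd : blochState b (z.arg + Real.pi) + blochState b z.arg = LinearMap.id := by
    rw [blochState_eq, blochState_eq, hexp, ← neg_one_mul (Complex.exp _),
      ← Complex.ofReal_one, ← Complex.ofReal_neg, blochOp_real_mul]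
    push_cast
    module
  -- The outcome `n` is given the eigenprojection of `E(n)` for `-‖z‖`, its reversal the one for
  -- `‖z‖`. As the reversal has operator `-E(n)`, each outcome contributes `-‖z‖` to the trace sum.
  let f : MsgOrder ι → H →ₗ[𝕜] H := fun n' =>
    if n' = n then blochState b (z.arg + Real.pi)
    else if n' = Fin.revPerm.trans n then blochState b z.arg else 0
  have hf1 : f n = blochState b (z.arg + Real.pi) := if_pos rfl
  have hf2 : f (Fin.revPerm.trans n) = blochState b z.arg := by
    simp only [f, if_neg hne.symm, if_true]
  have hf3 : ∀ n', n' ≠ n ∧ n' ≠ Fin.revPerm.trans n → f n' = 0 := by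
    rintro n' ⟨h1, h2⟩
    simp only [f]
    rw [if_neg h1, if_neg h2]
  refine ⟨⟨f, fun n' => ?_, ?_⟩, ?_⟩
  · simp only [f]
    split_ifs
    · exact isPositive_blochState b _
    · exact isPositive_blochState b _
    · exact LinearMap.isPositive_zero
  · rw [Fintype.sum_eq_add _ _ hne hf3, hf1, hf2, hadd]
  · rw [guesswork_eq, Fintype.sum_eq_add _ _ hne (fun n' hn' => by simp [hf3 n' hn'])]
    simp only [hf1, hf2]
    rw [orderOp_revPerm_trans, h, LinearMap.neg_comp, map_neg]
    nth_rw 1 [hz]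
    rw [hz', blochOp_mul_exp_comp_blochState, blochOp_mul_exp_comp_blochState, LinearMap.map_smul,
      LinearMap.map_smul, trace_blochState, trace_blochState]
    simp
    ring

end guesswork

end Guesswork

end

theorem mainTheorem5 {𝕜 H ι : Type*} [RCLike 𝕜] [NormedAddCommGroup H] [InnerProductSpace 𝕜 H]
    [FiniteDimensional 𝕜 H] [Fintype ι] [DecidableEq ι] (hdim : Module.finrank 𝕜 H = 2)
    (M : Ensemble ι 𝕜 H) (hM : IsRegularPolygonal M) :
    -- the explicit ordering exists
    (∃ (b : OrthonormalBasis (Fin 2) 𝕜 H) (l : ι ≃ Fin (Fintype.card ι)),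
      IsCyclicLabelling M b l) ∧
    -- the optimal orderings are exactly the explicit ones
    (∀ n : MsgOrder ι, IsOptimal M n ↔
      ∃ (b : OrthonormalBasis (Fin 2) 𝕜 H) (l : ι ≃ Fin (Fintype.card ι)),
        IsCyclicLabelling M b l ∧ n = explicitOrder l) ∧
    -- the trace norm and the minimum guesswork
    IsLeast (Set.range fun N : Measurement (MsgOrder ι) 𝕜 H => guesswork M N) (minGuesswork M) ∧
    (∀ n : MsgOrder ι, IsOptimal M n →
      (Even (Fintype.card ι) → traceNorm (orderOp M n) =
        (Fintype.card ι : ℝ)⁻¹ * 2 * (Real.sin (Real.pi / Fintype.card ι) ^ 2)⁻¹ *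
          √(3 * Real.cos (Real.pi / Fintype.card ι) ^ 2 + 1)) ∧
      (Odd (Fintype.card ι) → traceNorm (orderOp M n) =
        (Fintype.card ι : ℝ)⁻¹ * Real.cos (Real.pi / (2 * Fintype.card ι)) *
          (Real.sin (Real.pi / (2 * Fintype.card ι)) ^ 2)⁻¹) ∧
      minGuesswork M =
        ((Fintype.card ι : ℝ) + 1) / 2 - 1 / 2 * traceNorm (orderOp M n)) := by

  obtain ⟨b, l, hl⟩ := exists_isCyclicLabelling hM
  have hN : 3 ≤ Fintype.card ι := hM.1
  have hne : Nonempty ι := Fintype.card_pos_iff.mp (by omega)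
  have hexp : ∀ n, IsOptimal M n → ∃ (b : OrthonormalBasis (Fin 2) 𝕜 H)
      (l : ι ≃ Fin (Fintype.card ι)), IsCyclicLabelling M b l ∧ n = explicitOrder l :=
    fun n hn => exists_explicitOrder_of_isOptimal hN hl hn
  have : Nonempty (MsgOrder ι) := ⟨l.symm⟩
  obtain ⟨n₀, hn₀⟩ := Finite.exists_max fun n : MsgOrder ι =>
    ‖blochSum (fun m => 2 * Real.pi * ((l m : ℝ) + 1) / Fintype.card ι) n‖
  have hopt : IsOptimal M n₀ := (isOptimal_iff_norm_blochSum_le hl n₀).mpr hn₀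
  have habs : ∀ (b : OrthonormalBasis (Fin 2) 𝕜 H) (l : ι ≃ Fin (Fintype.card ι)),
      IsCyclicLabelling M b l → absOp (orderOp M (explicitOrder l)) =
        (((2 * Fintype.card ι : ℝ)⁻¹ * ‖explicitSum (Fintype.card ι)‖ : ℝ) : 𝕜) •
          LinearMap.id := by
    intro b l hl
    rw [absOp_orderOp hl, blochSum_explicitOrder]
  have htrace : ∀ n, IsOptimal M n → traceNorm (orderOp M n) =
      (Fintype.card ι : ℝ)⁻¹ * ‖explicitSum (Fintype.card ι)‖ := by
    intro n hn
    obtain ⟨b', l', hl', rfl⟩ := hexp n hn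
    rw [traceNorm_orderOp hl', blochSum_explicitOrder]
  have hleast : IsLeast (Set.range fun P : Measurement (MsgOrder ι) 𝕜 H => guesswork M P)
      (((Fintype.card ι : ℝ) + 1) / 2 - 1 / 2 *
        ((Fintype.card ι : ℝ)⁻¹ * ‖explicitSum (Fintype.card ι)‖)) := by
    have hr : 1 / 2 * ((Fintype.card ι : ℝ)⁻¹ * ‖explicitSum (Fintype.card ι)‖) =
        (2 * Fintype.card ι : ℝ)⁻¹ * ‖explicitSum (Fintype.card ι)‖ := by
      rw [mul_inv]; ring
    obtain ⟨b', l', hl', rfl⟩ := hexp n₀ hopt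
    rw [hr]
    constructor
    · obtain ⟨P, hP⟩ := exists_guesswork_eq (by omega)
        (orderOp_eq_blochOp hl' (explicitOrder l'))
      refine ⟨P, hP.trans ?_⟩
      rw [norm_inv_two_card_mul, blochSum_explicitOrder]
    · rintro _ ⟨P, rfl⟩
      exact le_guesswork hdim (fun n => habs b' l' hl' ▸ hopt n) P
  have hmin : minGuesswork M = ((Fintype.card ι : ℝ) + 1) / 2 - 1 / 2 *
      ((Fintype.card ι : ℝ)⁻¹ * ‖explicitSum (Fintype.card ι)‖) := hleast.csInf_eq
  refine ⟨⟨b, l, hl⟩, fun n => ⟨hexp n, ?_⟩, hmin ▸ hleast, fun n hn => ⟨fun heven => ?_,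
    fun hodd => ?_, by rw [hmin, htrace n hn]⟩⟩
  -- The optimal `n₀` is itself explicit, and all explicit orderings share one absolute value, so
  -- each inherits optimality.
  · rintro ⟨b₁, l₁, hl₁, rfl⟩ n'
    obtain ⟨b₂, l₂, hl₂, rfl⟩ := hexp n₀ hopt
    rw [habs b₁ l₁ hl₁, ← habs b₂ l₂ hl₂]
    exact hopt n'
  · rw [htrace n hn, norm_explicitSum_even hN heven]
    ring
  · rw [htrace n hn, norm_explicitSum_odd hN hodd]
    ring
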